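/- **Corollary.** Let $\alpha>1$ be a rational number, and let $\alpha=[a_1,\ldots,a_{2m}]=a_1+\cfrac{1}{a_2+\cfrac{1}{\ddots+\cfrac{1}{a_{2m}}}}$ be its regular continued fraction expansion of even length, with all $a_i\ge 1$. For $f,g\in\mathbb{Z}[q^{\pm1}]$ write $f\equiv g$ if $f=\pm q^{n}g$ for some $n\in\mathbb{Z}$; for $f\in\mathbb{Z}[q]$ put $f^\vee(q)=q^{\deg f}f(q^{-1})$, and call $f$ palindromic if $f=f^\vee$. Let $L(\alpha)$ be the rational link given by the following standard diagram on four horizontal strands, numbered from top to bottom. At the left end strands $1,2$ are joined and strands $3,4$ are joined; then come, from left to right, $a_1$ half twists of strands $2,3$, $a_2$ half twists of strands $1,2$, $a_3$ half twists of strands $2,3$, and so on up to $a_{2m}$ half twists of strands $1,2$; at the right end strands $1,4$ are joined and strands $2,3$ are joined. In the crossings of strands $2,3$ the over-strand runs from lower left to upper right, and in the crossings of strands $1,2$ it runs from upper left to lower right. Let $V_{L(\alpha)}(t)\in\mathbb{Z}[t^{\pm1/2}]$ be the Jones polynomial of $L(\alpha)$ with any orientation. The normalized Jones polynomial $J_\alpha(q)$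 is the unique polynomial in $\mathbb{Z}[q]$ with $J_\alpha(0)=1$ such that, under $q=-t^{-1}$, $J_\alpha(q)=\pm t^{-h}V_{L(\alpha)}(t)$ for some $h\in\tfrac12\mathbb{Z}$; it exists and does not depend on the orientation. If $J_\alpha$ is palindromic, put $I_\alpha=0$. If $J_\alpha$ is not palindromic, then $1-q$ divides $J_\alpha^\vee-J_\alpha$, and there is a unique palindromic polynomial $I_\alpha\in\mathbb{Z}[q]$ with $I_\alpha(0)>0$ and $$I_\alpha(q)\equiv\frac{J_\alpha(q)^\vee-J_\alpha(q)}{1-q}.$$ Let $R_q=\begin{pmatrix}q&1\\0&1\end{pmatrix}$, $S_q=\begin{pmatrix}0&-q^{-1}\\1&0\end{pmatrix}$, $L_q=\begin{pmatrix}1&0\\1&q^{-1}\end{pmatrix}$ and $M_q(a_1,\ldots,a_{2m})=R_q^{a_1}L_q^{a_2}\cdots R_q^{a_{2m-1}}L_q^{a_{2m}}$. Then $$I_\alpha(q)\equiv\operatorname{Tr}\bigl((-S_q)\,M_q(a_1,\ldots,a_{2m})\bigr),$$ all coefficients of $I_\alpha$ are non-negative integers, and $I_\alpha(0)=1$ whenever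 $J_\alpha$ is not palindromic. -/

import Mathlib

open Polynomial LaurentPolynomial

noncomputable section

/-! ### Link diagrams in plat form -/

/-- A planar system of caps joining `m` points on a vertical line in pairs: a fixed-point-free
involution whose pairs do not cross. -/
structure CapSystem (m : ℕ) where
  mate : Fin m → Fin m
  mate_mate : ∀ p, mate (mate p) = p
  mate_ne : ∀ p, mate p ≠ p
  noncrossing : ∀ p r, p < r → r < mate p → p < mate r ∧ mate r < mate p

/-- A link diagram in plat form on `n + 1` horizontal strands, numbered `0, …, n` from top to
bottom. The diagram is read from left to right: the caps `left`, then the crossings of `word`,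
then the caps `right`. A letter `(i, b)` is a crossing of the strands in positions `i` and `i + 1`.
If `b = true` the over-strand runs from upper left to lower right; if `b = false` the over-strand
runs from lower left to upper right. -/
structure PlatDiagram (n : ℕ) where
  left : CapSystem (n + 1)
  word : List (Fin n × Bool)
  right : CapSystem (n + 1)

namespace PlatDiagram

variable {n : ℕ} (D : PlatDiagram n)

/-- The number of crossings. -/
abbrev size : ℕ := D.word.length

/-- The points of the diagram on the vertical lines that separate consecutive crossings:
`(k, p)` lies in position `p` just after the first `k` crossings. -/
abbrev Pt : Type := Fin (D.size + 1) × Fin (n + 1)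

/-- The upper one of the two positions involved in the `k`-th crossing. -/
def upper (k : Fin D.size) : Fin (n + 1) := (D.word.get k).1.castSucc

/-- The lower one of the two positions involved in the `k`-th crossing. -/
def lower (k : Fin D.size) : Fin (n + 1) := (D.word.get k).1.succ

/-- Whether the over-strand of the `k`-th crossing descends from left to right. -/
def overDescends (k : Fin D.size) : Bool := (D.word.get k).2

/-- The arcs of the diagram obtained by smoothing every crossing according to `s`, where
`s k = true` means the `A`-smoothing (it joins the two regions swept out by rotating the over-strand
counterclockwise) and `s k = false` means the `B`-smoothing. For a descending over-strand the
`A`-smoothing gives two horizontal arcs and the `B`-smoothing gives two caps; for an ascending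
over-strand it is the other way round. -/
inductive SmoothArc (s : Fin D.size → Bool) : D.Pt → D.Pt → Prop
  | left (p) : SmoothArc s (0, p) (0, D.left.mate p)
  | right (p) : SmoothArc s (Fin.last _, p) (Fin.last _, D.right.mate p)
  | straight (k : Fin D.size) (p) (hu : p ≠ D.upper k) (hl : p ≠ D.lower k) :
      SmoothArc s (k.castSucc, p) (k.succ, p)
  | horizontal_upper (k : Fin D.size) (h : s k = D.overDescends k) :
      SmoothArc s (k.castSucc, D.upper k) (k.succ, D.upper k)
  | horizontal_lower (k : Fin D.size) (h : s k = D.overDescends k) :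
      SmoothArc s (k.castSucc, D.lower k) (k.succ, D.lower k)
  | cap_left (k : Fin D.size) (h : s k ≠ D.overDescends k) :
      SmoothArc s (k.castSucc, D.upper k) (k.castSucc, D.lower k)
  | cap_right (k : Fin D.size) (h : s k ≠ D.overDescends k) :
      SmoothArc s (k.succ, D.upper k) (k.succ, D.lower k)

/-- The number of closed curves of the state `s`. -/
def loops (s : Fin D.size → Bool) : ℕ := Nat.card (Quot (D.SmoothArc s))

/-- The Kauffman bracket in `ℤ[A, A⁻¹]`, where `T k` stands for `A ^ k`, normalized to be `1` on a
circle without crossings. -/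
def bracket : ℤ[T;T⁻¹] :=
  ∑ s : Fin D.size → Bool,
    T (∑ k, if s k then 1 else -1) * (-T 2 - T (-2)) ^ (D.loops s - 1)

/-- An orientation of the link: a direction (`true` for rightward) at every point, consistent along
the strands. -/
structure Orientation where
  rightward : D.Pt → Bool
  left (p) : rightward (0, D.left.mate p) = !rightward (0, p)
  right (p) : rightward (Fin.last _, D.right.mate p) = !rightward (Fin.last _, p)
  straight (k : Fin D.size) (p) (hu : p ≠ D.upper k) (hl : p ≠ D.lower k) :
    rightward (k.succ, p) = rightward (k.castSucc, p)
  descending (k : Fin D.size) :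
    rightward (k.succ, D.lower k) = rightward (k.castSucc, D.upper k)
  ascending (k : Fin D.size) :
    rightward (k.succ, D.upper k) = rightward (k.castSucc, D.lower k)

/-- The sign of the `k`-th crossing. If both strands are directed to the right (or both to the left),
the crossing is positive exactly when the over-strand descends; reversing one strand changes the
sign. -/
def crossingSign (o : D.Orientation) (k : Fin D.size) : ℤ :=
  if (o.rightward (k.castSucc, D.upper k) = o.rightward (k.castSucc, D.lower k)) ↔
      D.overDescends k = true then 1 else -1

/-- The writhe of the oriented diagram. -/
def writhe (o : D.Orientation) : ℤ := ∑ k, D.crossingSign o k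

/-- The Jones polynomial `V(t) = (-A³)^(-w) ⟨D⟩` of the oriented link, written in the variable
`A = t^(-1/4)`; thus `t ^ h` is `T (-4 * h)`. -/
def jones (o : D.Orientation) : ℤ[T;T⁻¹] :=
  ((D.writhe o).negOnePow : ℤ) • (T (-3 * D.writhe o) * D.bracket)

end PlatDiagram

/-- `f ≡ g`: equality in `ℤ[q, q⁻¹]` up to a factor `± q ^ k`. -/
def EquivUnit (f g : ℤ[T;T⁻¹]) : Prop := ∃ (ε : ℤˣ) (k : ℤ), f = (ε : ℤ) • (T k * g)

/-- `J` is the normalized Jones polynomial of the link of `D`: a polynomial in `q` with constant term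
`1` which is obtained from `V(t)` by the substitution `t = -q⁻¹` and a factor `± t ^ (-h)`,
`h ∈ ½ℤ`. In terms of `A`, one has `q = -t⁻¹ = -A⁴`. The condition does not depend on the orientation,
so that it is required for all of them. -/
def IsNormalizedJones {n : ℕ} (D : PlatDiagram n) (J : ℤ[X]) : Prop :=
  J.coeff 0 = 1 ∧ ∀ o : D.Orientation,
    EquivUnit (D.jones o) (Polynomial.eval₂ (Int.castRingHom ℤ[T;T⁻¹]) (-T 4) J)

/-! ### Continued fractions and rational links -/

/-- The value of the continued fraction `[a₁, a₂, …]`. Since `0⁻¹ = 0`, the value of `[a₁]` is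
`a₁`. -/
def cfValue : List ℕ → ℚ
  | [] => 0
  | a :: l => a + (cfValue l)⁻¹

/-- `a` is the regular continued fraction expansion of even length of the rational number `α > 1`. -/
structure IsEvenExpansion (α : ℚ) (a : List ℕ) : Prop where
  even : Even a.length
  pos : ∀ x ∈ a, 0 < x
  value : cfValue a = α

/-- Every rational number `α > 1` has an expansion of even length (so that the definition is not
void); the expansion is unique by the usual argument. -/
theorem exists_isEvenExpansion (α : ℚ) (hα : 1 < α) : ∃ a, IsEvenExpansion α a := by
  have key : ∀ s r : ℕ, 0 < s → s < r →
      (∃ a : List ℕ, Even a.length ∧ (∀ x ∈ a, 0 < x) ∧ cfValue a = (r : ℚ) / s) ∧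
      (∃ a : List ℕ, ¬ Even a.length ∧ (∀ x ∈ a, 0 < x) ∧ cfValue a = (r : ℚ) / s) := by
    intro s
    induction s using Nat.strong_induction_on with
    | _ s ih =>
      intro r hs hr
      have hs' : (s : ℚ) ≠ 0 := by positivity
      have hdiv : s * (r / s) + r % s = r := Nat.div_add_mod r s
      have hk : 0 < r / s := Nat.div_pos hr.le hs
      rcases Nat.eq_zero_or_pos (r % s) with h0 | h0
      · rw [h0, add_zero] at hdiv
        have hval : ((r / s : ℕ) : ℚ) = (r : ℚ) / s := by
          rw [eq_div_iff hs', mul_comm]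
          exact_mod_cast hdiv
        have hk2 : 1 < r / s := by
          by_contra hcon
          have h1 : r / s = 1 := by omega
          rw [h1] at hdiv
          omega
        refine ⟨⟨[r / s - 1, 1], by simp, ?_, ?_⟩, ⟨[r / s], by simp, ?_, ?_⟩⟩
        · intro x hx
          simp at hx
          omega
        · rw [← hval]
          simp [cfValue, Nat.cast_sub hk2.le]
        · simpa using ⟨hs, hr.le⟩
        · simp [cfValue, hval]
      · have hval : ((r / s : ℕ) : ℚ) + ((s : ℚ) / (r % s : ℕ))⁻¹ = (r : ℚ) / s := by
          rw [inv_div, eq_div_iff hs', add_mul, div_mul_cancel₀ _ hs', mul_comm]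
          exact_mod_cast hdiv
        obtain ⟨⟨b, hb1, hb2, hb3⟩, ⟨c, hc1, hc2, hc3⟩⟩ :=
          ih (r % s) (Nat.mod_lt _ hs) s h0 (Nat.mod_lt _ hs)
        refine ⟨⟨(r / s) :: c, ?_, ?_, ?_⟩, ⟨(r / s) :: b, ?_, ?_, ?_⟩⟩
        · simpa [Nat.even_add_one] using hc1
        · intro x hx
          rcases List.mem_cons.1 hx with rfl | hx
          exacts [hk, hc2 x hx]
        · rw [cfValue, hc3, hval]
        · simpa [Nat.even_add_one] using hb1
        · intro x hx
          rcases List.mem_cons.1 hx with rfl | hx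
          exacts [hk, hb2 x hx]
        · rw [cfValue, hb3, hval]
  have hnum : 0 < α.num := Rat.num_pos.2 (by linarith)
  have hcast : ((α.num.toNat : ℕ) : ℚ) = (α.num : ℚ) := by
    exact_mod_cast Int.toNat_of_nonneg hnum.le
  have hden : (0 : ℚ) < α.den := by exact_mod_cast α.den_pos
  have hα' : (α.num : ℚ) / α.den = α := Rat.num_div_den α
  have hlt : α.den < α.num.toNat := by
    have h : (α.den : ℚ) < α.num.toNat := by
      rw [hcast]
      rw [← hα', lt_div_iff₀ hden, one_mul] at hα
      exact hα
    exact_mod_cast h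
  obtain ⟨a, h1, h2, h3⟩ := (key α.den α.num.toNat α.den_pos hlt).1
  exact ⟨a, h1, h2, by rw [h3, hcast, hα']⟩

/-- The crossings of the diagram of the rational link: `a₁` half twists of the second and third
strand with ascending over-strands, then `a₂` half twists of the first and second strand with
descending over-strands, and so on alternately. -/
def rationalWord : List ℕ → List (Fin 3 × Bool)
  | [] => []
  | [a] => List.replicate a (1, false)
  | a :: b :: l => List.replicate a (1, false) ++ List.replicate b (0, true) ++ rationalWord l

/-- The standard diagram of the rational link with continued fraction `[a₁, …, a₂ₘ]`. On the left
the first strand is joined to the second one and the third to the fourth; on the right the first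
strand is joined to the fourth one and the second to the third. -/
def rationalLink (a : List ℕ) : PlatDiagram 3 where
  left :=
    { mate := ![1, 0, 3, 2]
      mate_mate := by decide
      mate_ne := by decide
      noncrossing := by decide }
  word := rationalWord a
  right :=
    { mate := ![3, 2, 1, 0]
      mate_mate := by decide
      mate_ne := by decide
      noncrossing := by decide }

/-! ### `q`-deformed matrices; here `T k` stands for `q ^ k` -/

def Rq : Matrix (Fin 2) (Fin 2) ℤ[T;T⁻¹] := !![T 1, 1; 0, 1]

def Sq : Matrix (Fin 2) (Fin 2) ℤ[T;T⁻¹] := !![0, -T (-1); 1, 0]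

def Lq : Matrix (Fin 2) (Fin 2) ℤ[T;T⁻¹] := !![1, 0; 1, T (-1)]

/-- `M_q(a₁, …, a₂ₘ) = R_q ^ a₁ * L_q ^ a₂ * ⋯ * R_q ^ a₂ₘ₋₁ * L_q ^ a₂ₘ`. -/
def Mq : List ℕ → Matrix (Fin 2) (Fin 2) ℤ[T;T⁻¹]
  | [] => 1
  | [a] => Rq ^ a
  | a :: b :: l => Rq ^ a * Lq ^ b * Mq l

/-! ### Palindromic polynomials and the polynomial `I` -/

/-- `f = f^∨`, where `f^∨ = q ^ (deg f) * f(q⁻¹)` is `Polynomial.reverse f`. -/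
def IsPalindromic (f : ℤ[X]) : Prop := f = f.reverse

/-- `I` is the polynomial attached to `J`: if `J` is palindromic then `I = 0`; otherwise `I` is a
palindromic polynomial with `I(0) > 0` and `I ≡ (J^∨ - J) / (1 - q)`. -/
def IsNormalizedQuotient (J I : ℤ[X]) : Prop :=
  (IsPalindromic J → I = 0) ∧
  (¬ IsPalindromic J → IsPalindromic I ∧ 0 < I.coeff 0 ∧
    ∃ Q : ℤ[X], J.reverse - J = (1 - X) * Q ∧ EquivUnit (toLaurent I) (toLaurent Q))

end

/-! Record the crossings, from left to right, as a word in two letters, give each letter a 2 × 2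
matrix over ℤ[q] with nonnegative coefficients (`letterMat`), and let M be the product over a word
of length n. Resolving the leftmost crossing only ever leaves two closures of the remaining word:
parallel or nested left caps. With q = -A⁴ the two brackets, suitably rescaled, are transformed by
the letter matrices up to units, and the empty word gives the vector (1, q - 1). Hence J = M₀₀ + (q
- 1) M₀₁ (`exists_closureBracket_eq`).

The reversal of J comes from `unitarity`, which intertwines M(q⁻¹) with q⁻ⁿ M(q): one matrix entry
yields J^∨ = M₀₀ + (q - 1) q⁻¹ M₁₀. Therefore (J^∨ - J) / (1 - q) = M₀₁ - q⁻¹ M₁₀, and q times this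
is the trace of q S_q M. Up to powers of q and conjugation by diag(1, q), the matrices R_q and L_q
are the letter matrices at q⁻¹. Since the quotient is invariant under q ↦ q⁻¹ up to a unit, it
agrees with the trace in the theorem.

For positivity, the letters next to S_q on its two sides in the cyclic word are absorbed in pairs
(`exists_trace_symplecticMat_mul`). Different letters merely rescale S_q; equal letters turn it into
a letter, leaving the trace of a positive word, with constant term 1. If S_q survives to the end,
the trace is 0, which is the palindromic case. -/

noncomputable section

/-! ### Equality up to units -/

namespace EquivUnit

variable {f g h : ℤ[T;T⁻¹]}

lemma symm (h : EquivUnit f g) : EquivUnit g f := by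
  obtain ⟨ε, k, rfl⟩ := h
  refine ⟨ε, -k, ?_⟩
  rw [mul_smul_comm, smul_smul, ← mul_assoc, ← T_add]
  simp [← Units.val_mul]

lemma trans (h₁ : EquivUnit f g) (h₂ : EquivUnit g h) : EquivUnit f h := by
  obtain ⟨ε, k, rfl⟩ := h₁
  obtain ⟨ε', k', rfl⟩ := h₂
  refine ⟨ε * ε', k + k', ?_⟩
  rw [mul_smul_comm, smul_smul, ← mul_assoc, ← T_add, Units.val_mul]

lemma T_mul (k : ℤ) (f : ℤ[T;T⁻¹]) : EquivUnit (T k * f) f := ⟨1, k, by simp⟩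

lemma invert (h : EquivUnit f g) :
    EquivUnit (LaurentPolynomial.invert f) (LaurentPolynomial.invert g) := by
  obtain ⟨ε, k, rfl⟩ := h
  exact ⟨ε, -k, by simp⟩

lemma eq_zero_iff (h : EquivUnit f g) : f = 0 ↔ g = 0 := by
  constructor
  · intro hf
    obtain ⟨ε, k, h⟩ := h.symm
    simp [h, hf]
  · intro hg
    obtain ⟨ε, k, h⟩ := h
    simp [h, hg]

end EquivUnit

/-- Two polynomials with nonzero constant terms which agree up to a power of `q` and a sign agree up
to this sign. -/
lemma eq_smul_of_toLaurent_eq {F G : ℤ[X]} (hF : F.coeff 0 ≠ 0) (hG : G.coeff 0 ≠ 0) {ε : ℤˣ}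
    {k : ℤ} (h : toLaurent F = (ε : ℤ) • (T k * toLaurent G)) : F = (ε : ℤ) • G := by
  have key : ∀ {F G : ℤ[X]} (k : ℕ), F.coeff 0 ≠ 0 →
      toLaurent F = (ε : ℤ) • (T k * toLaurent G) → F = (ε : ℤ) • G := by
    intro F G k hF h
    have h' : F = (ε : ℤ) • (X ^ k * G) := by
      apply toLaurent_injective
      rw [h, map_zsmul, map_mul, toLaurent_X_pow]
    rcases k with _ | k
    · simpa using h'
    · rw [h'] at hF
      simp [mul_coeff_zero] at hF
  obtain ⟨m, rfl | rfl⟩ := k.eq_nat_or_neg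
  · exact key m hF h
  · have := key (F := G) (G := F) m hG (by
      rw [h, mul_smul_comm, smul_smul, ← mul_assoc, ← T_add]
      simp [← Units.val_mul])
    rw [this, smul_smul]
    simp [← Units.val_mul]

/-- Two polynomials with positive constant terms which agree up to a unit of `ℤ[q, q⁻¹]` are
equal. -/
lemma eq_of_equivUnit_toLaurent {F G : ℤ[X]} (hF : 0 < F.coeff 0) (hG : 0 < G.coeff 0)
    (h : EquivUnit (toLaurent F) (toLaurent G)) : F = G := by
  obtain ⟨ε, k, hk⟩ := h
  have := eq_smul_of_toLaurent_eq hF.ne' hG.ne' hk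
  rcases Int.units_eq_one_or ε with rfl | rfl
  · simpa using this
  · simp [this] at hF
    omega

/-- If `G` is `q ^ n * F(q⁻¹)` and both have nonzero constant term, then `G` is the reversal of
`F`. -/
lemma reverse_eq_of_toLaurent {F G : ℤ[X]} (hF : F.coeff 0 ≠ 0) (hG : G.coeff 0 ≠ 0) {n : ℤ}
    (h : toLaurent G = T n * invert (toLaurent F)) : F.reverse = G := by
  have h2 : toLaurent F.reverse = ((1 : ℤˣ) : ℤ) • (T (F.natDegree - n) * toLaurent G) := by
    rw [toLaurent_reverse, h, ← mul_assoc, ← T_add, mul_comm]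
    simp
  have hF0 : F ≠ 0 := by
    rintro rfl
    simp at hF
  simpa using eq_smul_of_toLaurent_eq
    (by rwa [coeff_zero_reverse, Ne, leadingCoeff_eq_zero]) hG h2

/-! ### Nonnegative coefficients -/

lemma coeff_mul_nonneg {F G : ℤ[X]} (hF : ∀ k, 0 ≤ F.coeff k) (hG : ∀ k, 0 ≤ G.coeff k) (k : ℕ) :
    0 ≤ (F * G).coeff k := by
  rw [coeff_mul]
  exact Finset.sum_nonneg fun x _ => mul_nonneg (hF _) (hG _)

/-! ### Products of the letter matrices -/

lemma matrix_fin_two_congr {R : Type*} {a b c d a' b' c' d' : R} (ha : a = a') (hb : b = b')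
    (hc : c = c') (hd : d = d') : !![a, b; c, d] = !![a', b'; c', d'] := by
  rw [ha, hb, hc, hd]

/-- The matrices by which the crossings act on the pair of brackets of the two plat closures. -/
def letterMat (b : Bool) : Matrix (Fin 2) (Fin 2) ℤ[X] :=
  if b then !![1, 0; X, X] else !![1, 1; 0, X]

lemma letterMat_map {R : Type*} [CommRing R] (f : ℤ[X] →+* R) (b : Bool) :
    (letterMat b).map f = if b then !![f 1, f 0; f X, f X] else !![f 1, f 1; f 0, f X] := by
  cases b <;> ext i j : 2 <;> fin_cases i <;> fin_cases j <;> simp [letterMat]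

/-- The product of the letter matrices of a word. -/
def wordMat (w : List Bool) : Matrix (Fin 2) (Fin 2) ℤ[X] := (w.map letterMat).prod

@[simp] lemma wordMat_nil : wordMat [] = 1 := rfl

lemma wordMat_cons (b : Bool) (w : List Bool) : wordMat (b :: w) = letterMat b * wordMat w := by
  simp [wordMat]

lemma wordMat_false_cons_zero (w : List Bool) (j : Fin 2) :
    wordMat (false :: w) 0 j = wordMat w 0 j + wordMat w 1 j := by
  simp [wordMat_cons, letterMat, Matrix.mul_apply]

lemma wordMat_false_cons_one (w : List Bool) (j : Fin 2) :
    wordMat (false :: w) 1 j = X * wordMat w 1 j := by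
  simp [wordMat_cons, letterMat, Matrix.mul_apply]

lemma wordMat_true_cons_zero (w : List Bool) (j : Fin 2) :
    wordMat (true :: w) 0 j = wordMat w 0 j := by
  simp [wordMat_cons, letterMat, Matrix.mul_apply]

lemma wordMat_true_cons_one (w : List Bool) (j : Fin 2) :
    wordMat (true :: w) 1 j = X * (wordMat w 0 j + wordMat w 1 j) := by
  simp [wordMat_cons, letterMat, Matrix.mul_apply, mul_add]

lemma wordMat_append (v w : List Bool) : wordMat (v ++ w) = wordMat v * wordMat w := by
  simp [wordMat]

lemma wordMat_nonneg (w : List Bool) (i j : Fin 2) (k : ℕ) : 0 ≤ (wordMat w i j).coeff k := by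
  induction w generalizing i j k with
  | nil =>
    fin_cases i <;> fin_cases j <;> simp [coeff_one] <;> split_ifs <;> simp
  | cons b w ih =>
    have hl : ∀ i j k, 0 ≤ (letterMat b i j).coeff k := by
      intro i j k
      cases b <;> fin_cases i <;> fin_cases j <;> simp [letterMat, coeff_one, coeff_X] <;>
        split_ifs <;> simp
    rw [wordMat_cons, Matrix.mul_apply, finsetSum_coeff]
    exact Finset.sum_nonneg fun l _ => coeff_mul_nonneg (hl _ _) (ih _ _) k

/-- Modulo q both letter matrices have zero second row and (0, 0) entry 1. All constant terms needed
below follow from this. -/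
lemma wordMat_one_row_dvd (b : Bool) (w : List Bool) (j : Fin 2) :
    X ∣ wordMat (b :: w) 1 j := by
  cases b <;>
    simp [wordMat_cons, letterMat, Matrix.mul_apply, ← mul_add]

lemma wordMat_one_zero_dvd (w : List Bool) : X ∣ wordMat w 1 0 := by
  cases w with
  | nil => simp
  | cons b w => exact wordMat_one_row_dvd b w 0

lemma wordMat_zero_zero_coeff (w : List Bool) : (wordMat w 0 0).coeff 0 = 1 := by
  induction w with
  | nil => simp
  | cons b w ih =>
    have := X_dvd_iff.1 (wordMat_one_zero_dvd w)
    cases b <;> simp [wordMat_cons, letterMat, Matrix.mul_apply, ih, this]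

/-- The second column of the letter `true` is divisible by q. This makes J(0) = 1. -/
lemma wordMat_append_true_zero_one_coeff (w : List Bool) :
    (wordMat (w ++ [true]) 0 1).coeff 0 = 0 := by
  simp [wordMat_append, wordMat_cons, letterMat, Matrix.mul_apply]

/-- At least one letter is needed: the empty word has trace 2. -/
lemma trace_wordMat_cons_coeff (b : Bool) (w : List Bool) :
    (wordMat (b :: w)).trace.coeff 0 = 1 := by
  rw [Matrix.trace_fin_two, coeff_add, wordMat_zero_zero_coeff,
    X_dvd_iff.1 (wordMat_one_row_dvd b w 1), add_zero]

/-! ### Traces against `S_q` -/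

/-- The matrix `q S_q`. -/
def symplecticMat : Matrix (Fin 2) (Fin 2) ℤ[X] := !![0, -1; X, 0]

/-- Each letter matrix is the transpose of the other, conjugated by diag(1, q). So this is the
symplectic identity A S Aᵗ = det(A) S, with determinant q. -/
lemma letterMat_mul_symplecticMat_mul_of_ne {x y : Bool} (h : y ≠ x) :
    letterMat y * symplecticMat * letterMat x = (X : ℤ[X]) • symplecticMat := by
  cases x <;> cases y <;> simp at h <;> ext i j : 2 <;> fin_cases i <;> fin_cases j <;>
    simp [letterMat, symplecticMat, Matrix.mul_apply]

/-- A deformation of the relations R S R = L and L S L = -R in SL₂(ℤ). -/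
lemma letterMat_mul_symplecticMat_mul_self (x : Bool) :
    letterMat x * symplecticMat * letterMat x =
      (((if x then -1 else 1 : ℤˣ) : ℤ) : ℤ[X]) • (X : ℤ[X]) • letterMat (!x) := by
  cases x <;> ext i j : 2 <;> fin_cases i <;> fin_cases j <;>
    simp [letterMat, symplecticMat, Matrix.mul_apply]

/-- The trace of a positive word times `S_q` vanishes or is, up to a unit, the trace of a nonempty
positive word. -/
lemma exists_trace_symplecticMat_mul (w : List Bool) :
    ∃ (ε : ℤˣ) (k : ℕ) (F : ℤ[X]), (symplecticMat * wordMat w).trace = (ε : ℤ) • (X ^ k * F) ∧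
      (∀ j, 0 ≤ F.coeff j) ∧ (F ≠ 0 → F.coeff 0 = 1) := by
  induction w using List.bidirectionalRec with
  | nil =>
    exact ⟨1, 0, 0, by simp [symplecticMat, Matrix.trace_fin_two], by simp, by simp⟩
  | singleton b =>
    refine ⟨if b then -1 else 1, 1, 1, ?_, ?_, by simp⟩
    · cases b <;> simp [symplecticMat, Matrix.trace_fin_two, wordMat_cons, letterMat]
    · intro j
      rw [coeff_one]
      split_ifs <;> simp
  | cons_append x w y ih =>
    -- Cyclicity of the trace moves the last letter in front of S, so that S stands between the last
    -- and the first letter.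
    have h : (symplecticMat * wordMat (x :: (w ++ [y]))).trace =
        (letterMat y * symplecticMat * letterMat x * wordMat w).trace := by
      rw [wordMat_cons, wordMat_append, Matrix.mul_assoc (letterMat y),
        Matrix.mul_assoc (letterMat y), Matrix.trace_mul_comm (letterMat y)]
      simp [wordMat, Matrix.mul_assoc]
    rw [h]
    by_cases hxy : y = x
    · subst hxy
      refine ⟨if y then -1 else 1, 1, (wordMat ((!y) :: w)).trace, ?_, ?_, ?_⟩
      · rw [letterMat_mul_symplecticMat_mul_self, wordMat_cons]
        simp only [Matrix.smul_mul, Matrix.trace_smul, smul_eq_mul, pow_one, zsmul_eq_mul]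
      · intro j
        rw [Matrix.trace_fin_two, coeff_add]
        exact add_nonneg (wordMat_nonneg _ _ _ _) (wordMat_nonneg _ _ _ _)
      · exact fun _ => trace_wordMat_cons_coeff _ _
    · obtain ⟨ε, k, F, hF, h1, h2⟩ := ih
      refine ⟨ε, k + 1, F, ?_, h1, h2⟩
      rw [letterMat_mul_symplecticMat_mul_of_ne hxy, Matrix.smul_mul, Matrix.trace_smul, hF,
        smul_eq_mul, mul_smul_comm, pow_succ', mul_assoc]

/-! ### The substitution `q ↦ q⁻¹` -/

/-- The ring homomorphism `f ↦ f(q⁻¹)` to Laurent polynomials. -/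
def toLaurentInv : ℤ[X] →+* ℤ[T;T⁻¹] :=
  (invert : ℤ[T;T⁻¹] ≃ₐ[ℤ] ℤ[T;T⁻¹]).toRingEquiv.toRingHom.comp toLaurent

lemma toLaurentInv_apply (f : ℤ[X]) : toLaurentInv f = invert (toLaurent f) := rfl

@[simp] lemma toLaurentInv_X : toLaurentInv X = T (-1) := by simp [toLaurentInv_apply]

lemma T_one_mul_T_neg_one : (T 1 * T (-1) : ℤ[T;T⁻¹]) = 1 := by rw [← T_add]; simp

/-- The intertwiner between the Burau representation and its image under `q ↦ q⁻¹`. -/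
def unitaryMat : Matrix (Fin 2) (Fin 2) ℤ[T;T⁻¹] := !![1, 1 - T 1; T 1 - 1, T 1]

/-- Unitarity of the Burau representation. -/
lemma unitarity (w : List Bool) :
    unitaryMat * (wordMat w).map toLaurentInv =
      (T (-(w.length : ℤ)) : ℤ[T;T⁻¹]) • ((wordMat w).map toLaurent * unitaryMat) := by
  induction w with
  | nil => simp
  | cons b w ih =>
    -- It suffices to check single letters. Determinants force the scalar up to sign: a letter has
    -- determinant q, and q⁻¹ after the substitution.
    have hb : unitaryMat * (letterMat b).map toLaurentInv =
        (T (-1) : ℤ[T;T⁻¹]) • ((letterMat b).map toLaurent * unitaryMat) := by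
      have h := T_one_mul_T_neg_one
      cases b <;> simp only [letterMat_map, unitaryMat, Matrix.mul_fin_two, Matrix.smul_of,
        Matrix.smul_cons, Matrix.smul_empty, smul_eq_mul, map_one, map_zero, toLaurentInv_X,
        toLaurent_X, if_true, Bool.false_eq_true, if_false] <;>
        apply matrix_fin_two_congr <;> grind
    rw [wordMat_cons, Matrix.map_mul, ← Matrix.mul_assoc, hb, Matrix.smul_mul, Matrix.mul_assoc,
      ih, Matrix.mul_smul, smul_smul, ← T_add, Matrix.map_mul, Matrix.mul_assoc]
    congr 2
    simp only [List.length_cons]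
    push_cast
    ring

/-- The normalized Jones polynomial of the word. -/
def jonesPoly (w : List Bool) : ℤ[X] := wordMat w 0 0 + (X - 1) * wordMat w 0 1

/-- The reversal of the normalized Jones polynomial. -/
lemma toLaurent_jonesPoly_dual {w : List Bool} {c : ℤ[X]} (hc : wordMat w 1 0 = X * c) :
    toLaurent (wordMat w 0 0 + (X - 1) * c) =
      T w.length * invert (toLaurent (jonesPoly w)) := by
  -- The first column of `unitaryMat` is (1, q - 1), the bracket vector of the empty word, so the
  -- (0, 0) entry on the right is J up to a power of q.
  have h := congrFun (congrFun (unitarity w) 0) 0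
  simp [Matrix.mul_apply, unitaryMat, hc] at h
  have h2 : toLaurentInv (wordMat w 0 0 + (X - 1) * c) =
      T (-(w.length : ℤ)) * toLaurent (jonesPoly w) := by
    have h3 := T_one_mul_T_neg_one
    simp only [jonesPoly, map_add, map_mul, map_sub, toLaurentInv_X, toLaurent_X, map_one]
    linear_combination h + toLaurentInv c * h3
  have h4 := congrArg invert h2
  rw [toLaurentInv_apply, map_mul, invert_T, neg_neg] at h4
  rw [← h4]
  exact (involutive_invert _).symm

/-! ### The matrices `R_q`, `L_q` -/

/-- The letters of the word of a continued fraction. -/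
def cfWord (a : List ℕ) : List Bool := (rationalWord a).map Prod.snd

lemma Mq_eq_prod (a : List ℕ) : Mq a = ((cfWord a).map fun b => if b then Lq else Rq).prod := by
  induction a using rationalWord.induct with
  | case1 => simp [Mq, cfWord, rationalWord]
  | case2 a => simp [Mq, cfWord, rationalWord]
  | case3 a b l ih => simp [Mq, cfWord, rationalWord, ih, Matrix.mul_assoc]

/-- The matrix `diag(1, q)`. -/
def diagMat : Matrix (Fin 2) (Fin 2) ℤ[T;T⁻¹] := !![1, 0; 0, T 1]

lemma exists_prod_mul_diagonal (w : List Bool) : ∃ k : ℤ,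
    (w.map fun b => if b then Lq else Rq).prod * diagMat =
      (T k : ℤ[T;T⁻¹]) • (diagMat * (wordMat w).map toLaurentInv) := by
  induction w with
  | nil => exact ⟨0, by simp⟩
  | cons b w ih =>
    obtain ⟨k, hk⟩ := ih
    have hb : (if b then Lq else Rq) * diagMat =
        (T (if b then 0 else 1) : ℤ[T;T⁻¹]) • (diagMat * (letterMat b).map toLaurentInv) := by
      have h := T_one_mul_T_neg_one
      cases b <;> simp only [letterMat_map, diagMat, Lq, Rq, Matrix.mul_fin_two, Matrix.smul_of,
        Matrix.smul_cons, Matrix.smul_empty, smul_eq_mul, map_one, map_zero, toLaurentInv_X,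
        T_zero, if_true, Bool.false_eq_true, if_false] <;>
        apply matrix_fin_two_congr <;> grind
    refine ⟨k + if b then 0 else 1, ?_⟩
    rw [List.map_cons, List.prod_cons, Matrix.mul_assoc, hk, Matrix.mul_smul, ← Matrix.mul_assoc,
      hb, Matrix.smul_mul, smul_smul, ← T_add, wordMat_cons, Matrix.map_mul, Matrix.mul_assoc]

/-- Only the off-diagonal entries enter the trace; conjugation by diag(1, q) scales them by q and
q⁻¹. -/
lemma trace_Sq_mul_Mq (a : List ℕ) : EquivUnit (Matrix.trace (-Sq * Mq a))
    (toLaurentInv (symplecticMat * wordMat (cfWord a)).trace) := by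
  obtain ⟨k, hk⟩ := exists_prod_mul_diagonal (cfWord a)
  rw [← Mq_eq_prod] at hk
  have h1 := congrFun (congrFun hk 1) 0
  have h2 := congrFun (congrFun hk 0) 1
  simp only [Matrix.mul_apply, Matrix.smul_apply, Fin.sum_univ_two] at h1 h2
  simp [diagMat] at h1 h2
  rw [T_add] at h1
  refine ⟨-1, k, ?_⟩
  have h := T_one_mul_T_neg_one
  simp only [Matrix.trace_fin_two, Matrix.mul_apply, Fin.sum_univ_two]
  simp [Sq, symplecticMat]
  linear_combination T (-1) * h1 - T (-1) * h2 + (Mq a 0 1 + T k * toLaurentInv (wordMat (cfWord a) 1 0)) * h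

/-! ### Expansion of the bracket at the leftmost crossing -/

namespace PlatDiagram

variable {n : ℕ}

/-- The diagram with caps `c`, crossings `w` and caps `r`. -/
abbrev mk' (c : CapSystem (n + 1)) (w : List (Fin n × Bool)) (r : CapSystem (n + 1)) :
    PlatDiagram n := ⟨c, w, r⟩

lemma loops_pos (D : PlatDiagram n) (s : Fin D.size → Bool) : 0 < D.loops s := by
  have : Nonempty (Quot (D.SmoothArc s)) := ⟨Quot.mk _ (0, 0)⟩
  exact Nat.card_pos

variable (c c' r : CapSystem (n + 1)) (i : Fin n) (b : Bool) (w : List (Fin n × Bool))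
  (t : Fin w.length → Bool)

/-- The state of the diagram with one more crossing on the left. -/
abbrev consState (x : Bool) (i : Fin n) (b : Bool) {w : List (Fin n × Bool)}
    (t : Fin w.length → Bool) : Fin ((i, b) :: w).length → Bool :=
  Fin.cons (α := fun _ => Bool) x t

/-- The class of a point of the diagram with crossings `w`. -/
abbrev cls (k : Fin (w.length + 1)) (p : Fin (n + 1)) :
    Quot ((mk' c w r).SmoothArc t) := Quot.mk _ (k, p)

variable {c c' r i b w t}

lemma cls_left (p : Fin (n + 1)) : cls c r w t 0 (c.mate p) = cls c r w t 0 p :=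
  (Quot.sound (SmoothArc.left (D := mk' c w r) (s := t) p)).symm

lemma cls_right (p : Fin (n + 1)) :
    cls c r w t (Fin.last _) (r.mate p) = cls c r w t (Fin.last _) p :=
  (Quot.sound (SmoothArc.right (D := mk' c w r) (s := t) p)).symm

/-- The arcs away from the leftmost column give the same identifications after adding a crossing. -/
lemma cls_succ_of_arc {x : Bool} {β : Type*} (f : Pt (mk' c ((i, b) :: w) r) → β)
    (g : Quot ((mk' c' w r).SmoothArc t) → β)
    (hf : ∀ k p, f (Fin.succ k, p) = g (cls c' r w t k p))
    (hleft : ∀ p, f (0, c.mate p) = f (0, p))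
    (hstraight : ∀ p, p ≠ i.castSucc → p ≠ i.succ → f (0, p) = f (1, p))
    (hhor : x = b → f (0, i.castSucc) = f (1, i.castSucc) ∧ f (0, i.succ) = f (1, i.succ))
    (hcap : x ≠ b → f (0, i.castSucc) = f (0, i.succ) ∧ f (1, i.castSucc) = f (1, i.succ))
    (y z : Pt (mk' c ((i, b) :: w) r))
    (h : (mk' c ((i, b) :: w) r).SmoothArc (consState x i b t) y z) : f y = f z := by
  cases h with
  | left p => exact (hleft p).symm
  | right p =>
    exact ((hf (Fin.last _) p).trans (congrArg g (cls_right p).symm)).trans (hf _ _).symm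
  | straight k p hu hl =>
    cases k using Fin.cases with
    | zero => exact hstraight p hu hl
    | succ k =>
      exact ((hf k.castSucc p).trans (congrArg g (Quot.sound
        (SmoothArc.straight (D := mk' c' w r) (s := t) k p hu hl)))).trans (hf _ _).symm
  | horizontal_upper k h =>
    cases k using Fin.cases with
    | zero => exact (hhor h).1
    | succ k =>
      exact ((hf k.castSucc _).trans (congrArg g (Quot.sound
        (SmoothArc.horizontal_upper (D := mk' c' w r) (s := t) k h)))).trans (hf _ _).symm
  | horizontal_lower k h =>
    cases k using Fin.cases with
    | zero => exact (hhor h).2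
    | succ k =>
      exact ((hf k.castSucc _).trans (congrArg g (Quot.sound
        (SmoothArc.horizontal_lower (D := mk' c' w r) (s := t) k h)))).trans (hf _ _).symm
  | cap_left k h =>
    cases k using Fin.cases with
    | zero => exact (hcap h).1
    | succ k =>
      exact ((hf k.castSucc _).trans (congrArg g (Quot.sound
        (SmoothArc.cap_left (D := mk' c' w r) (s := t) k h)))).trans (hf _ _).symm
  | cap_right k h =>
    cases k using Fin.cases with
    | zero => exact (hcap h).2
    | succ k =>
      exact ((hf k.succ _).trans (congrArg g (Quot.sound
        (SmoothArc.cap_right (D := mk' c' w r) (s := t) k h)))).trans (hf _ _).symm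

/-- If the points of the second column of the larger diagram are identified as by the caps `c'`,
then all identifications of the smaller diagram hold in the larger one. -/
lemma cls_of_arc_succ {x : Bool}
    (hleft : ∀ p, cls c r ((i, b) :: w) (consState x i b t) 1 (c'.mate p) =
      cls c r ((i, b) :: w) (consState x i b t) 1 p)
    (y z : Pt (mk' c' w r)) (h : (mk' c' w r).SmoothArc t y z) :
    cls c r ((i, b) :: w) (consState x i b t) y.1.succ y.2 =
      cls c r ((i, b) :: w) (consState x i b t) z.1.succ z.2 := by
  cases h with
  | left p => exact (hleft p).symm
  | right p => exact (cls_right (w := (i, b) :: w) (t := consState x i b t) p).symm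
  | straight k p hu hl => exact Quot.sound (SmoothArc.straight (D := mk' c ((i, b) :: w) r)
      (s := consState x i b t) k.succ p hu hl)
  | horizontal_upper k h =>
    exact Quot.sound (SmoothArc.horizontal_upper (D := mk' c ((i, b) :: w) r)
      (s := consState x i b t) k.succ h)
  | horizontal_lower k h =>
    exact Quot.sound (SmoothArc.horizontal_lower (D := mk' c ((i, b) :: w) r)
      (s := consState x i b t) k.succ h)
  | cap_left k h =>
    exact Quot.sound (SmoothArc.cap_left (D := mk' c ((i, b) :: w) r)
      (s := consState x i b t) k.succ h)
  | cap_right k h =>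
    exact Quot.sound (SmoothArc.cap_right (D := mk' c ((i, b) :: w) r)
      (s := consState x i b t) k.succ h)

section FirstColumn

variable {x : Bool}

lemma cls_straight {p : Fin (n + 1)} (hu : p ≠ i.castSucc) (hl : p ≠ i.succ) :
    cls c r ((i, b) :: w) (consState x i b t) 1 p =
      cls c r ((i, b) :: w) (consState x i b t) 0 p :=
  (Quot.sound (SmoothArc.straight (D := mk' c ((i, b) :: w) r) (s := consState x i b t)
    (0 : Fin (w.length + 1)) p hu hl)).symm

lemma cls_horizontal (h : x = b) (p : Fin (n + 1)) :
    cls c r ((i, b) :: w) (consState x i b t) 1 p =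
      cls c r ((i, b) :: w) (consState x i b t) 0 p := by
  by_cases hu : p = i.castSucc
  · subst hu
    exact (Quot.sound (SmoothArc.horizontal_upper (D := mk' c ((i, b) :: w) r)
      (s := consState x i b t) (0 : Fin (w.length + 1)) h)).symm
  by_cases hl : p = i.succ
  · subst hl
    exact (Quot.sound (SmoothArc.horizontal_lower (D := mk' c ((i, b) :: w) r)
      (s := consState x i b t) (0 : Fin (w.length + 1)) h)).symm
  exact cls_straight hu hl

lemma cls_cap_left (h : x ≠ b) :
    cls c r ((i, b) :: w) (consState x i b t) 0 i.castSucc =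
      cls c r ((i, b) :: w) (consState x i b t) 0 i.succ :=
  Quot.sound (SmoothArc.cap_left (D := mk' c ((i, b) :: w) r) (s := consState x i b t)
    (0 : Fin (w.length + 1)) h)

lemma cls_cap_right (h : x ≠ b) :
    cls c r ((i, b) :: w) (consState x i b t) 1 i.castSucc =
      cls c r ((i, b) :: w) (consState x i b t) 1 i.succ :=
  Quot.sound (SmoothArc.cap_right (D := mk' c ((i, b) :: w) r) (s := consState x i b t)
    (0 : Fin (w.length + 1)) h)

end FirstColumn

/-- Smoothing the leftmost crossing horizontally removes it. -/
lemma loops_cons_horizontal :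
    (mk' c ((i, b) :: w) r).loops (consState b i b t) = (mk' c w r).loops t := by
  refine Nat.card_congr
    { toFun := Quot.lift (fun y => Fin.cases (motive := fun _ => _) (cls c r w t 0 y.2)
        (fun k => cls c r w t k y.2) y.1) ?_
      invFun := Quot.lift (fun y => cls c r ((i, b) :: w) (consState b i b t) y.1.succ y.2) ?_
      left_inv := ?_
      right_inv := ?_ }
  · refine cls_succ_of_arc (c' := c) (t := t) (x := b) _ id (fun k p => rfl) (fun p => cls_left p)
      (fun p _ _ => rfl) (fun _ => ⟨rfl, rfl⟩) (fun h => absurd rfl h)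
  · refine cls_of_arc_succ (c' := c) fun p => ?_
    rw [cls_horizontal rfl, cls_horizontal rfl, cls_left]
  · rintro ⟨k, p⟩
    cases k using Fin.cases with
    | zero => exact cls_horizontal rfl p
    | succ k => rfl
  · rintro ⟨k, p⟩
    rfl

/-- Smoothing the leftmost crossing into two caps splits off a loop if the left caps join its two
strands. -/
lemma loops_cons_cap_of_mate (hc : c.mate i.castSucc = i.succ) :
    (mk' c ((i, b) :: w) r).loops (consState (!b) i b t) = (mk' c w r).loops t + 1 := by
  have hb : (!b) ≠ b := by simp
  have hc' : c.mate i.succ = i.castSucc := by rw [← hc, c.mate_mate]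
  have hu : ∀ p, c.mate p = i.castSucc ↔ p = i.succ := fun p =>
    ⟨fun h => by rw [← c.mate_mate p, h, hc], fun h => by rw [h, hc']⟩
  have hl : ∀ p, c.mate p = i.succ ↔ p = i.castSucc := fun p =>
    ⟨fun h => by rw [← c.mate_mate p, h, hc'], fun h => by rw [h, hc]⟩
  rw [loops, loops, ← Finite.card_option]
  refine Nat.card_congr
    -- `none` stands for the new loop, formed in column 0 by the left cap and the cap of the
    -- crossing.
    { toFun := Quot.lift (fun y => Fin.cases (motive := fun _ => _)
        (if y.2 = i.castSucc ∨ y.2 = i.succ then none else some (cls c r w t 0 y.2))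
        (fun k => some (cls c r w t k y.2)) y.1) ?_
      invFun := fun z => z.elim (cls c r ((i, b) :: w) (consState (!b) i b t) 0 i.castSucc)
        (Quot.lift (fun y => cls c r ((i, b) :: w) (consState (!b) i b t) y.1.succ y.2) ?_)
      left_inv := ?_
      right_inv := ?_ }
  · refine cls_succ_of_arc (c' := c) (t := t) (x := !b) _ some (fun k p => rfl) (fun p => ?_)
      (fun p h1 h2 => ?_) (fun h => absurd h hb) (fun _ => ⟨?_, ?_⟩)
    · simp only [Fin.cases_zero, hu, hl, cls_left, or_comm]
    · simp only [Fin.cases_zero, h1, h2, or_self, if_false]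
      rfl
    · simp
    · exact congrArg some ((congrArg _ hc).symm.trans (cls_left _)).symm
  · refine cls_of_arc_succ (c' := c) fun p => ?_
    by_cases h1 : p = i.castSucc
    · rw [h1, hc, cls_cap_right hb]
    by_cases h2 : p = i.succ
    · rw [h2, hc', cls_cap_right hb]
    rw [cls_straight h1 h2, cls_straight (by rwa [Ne, hu]) (by rwa [Ne, hl]), cls_left]
  · rintro ⟨k, p⟩
    cases k using Fin.cases with
    | zero =>
      by_cases h1 : p = i.castSucc
      · subst h1
        simp
      by_cases h2 : p = i.succ
      · subst h2
        simpa using cls_cap_left hb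
      simpa [h1, h2] using cls_straight h1 h2
    | succ k => rfl
  · rintro (_ | ⟨k, p⟩)
    · simp
    · rfl

/-- Smoothing the leftmost crossing into two caps when the left caps do not join its two strands. -/
lemma loops_cons_cap_of_mate_ne (hc : c.mate i.castSucc ≠ i.succ)
    (h1 : c'.mate i.castSucc = i.succ)
    (h2 : c'.mate (c.mate i.castSucc) = c.mate i.succ)
    (h3 : ∀ p, p ≠ i.castSucc → p ≠ i.succ → p ≠ c.mate i.castSucc → p ≠ c.mate i.succ →
      c'.mate p = c.mate p) :
    (mk' c ((i, b) :: w) r).loops (consState (!b) i b t) = (mk' c' w r).loops t := by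
  have hb : (!b) ≠ b := by simp
  have hc' : c.mate i.succ ≠ i.castSucc := fun h => hc (by rw [← h, c.mate_mate])
  have h1' : c'.mate i.succ = i.castSucc := by rw [← h1, c'.mate_mate]
  have h2' : c'.mate (c.mate i.succ) = c.mate i.castSucc := by rw [← h2, c'.mate_mate]
  have sw : ∀ p q, c.mate p = q ↔ p = c.mate q := fun p q =>
    ⟨fun h => by rw [← h, c.mate_mate], fun h => by rw [h, c.mate_mate]⟩
  refine Nat.card_congr
    -- In column 0 the two strands of the crossing turn back; they are followed through the left
    -- caps to their mates, which run straight on to the next column.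
    { toFun := Quot.lift (fun y => Fin.cases (motive := fun _ => _)
        (if y.2 = i.castSucc ∨ y.2 = i.succ then cls c' r w t 0 (c.mate y.2)
          else cls c' r w t 0 y.2)
        (fun k => cls c' r w t k y.2) y.1) ?_
      invFun := Quot.lift (fun y => cls c r ((i, b) :: w) (consState (!b) i b t) y.1.succ y.2) ?_
      left_inv := ?_
      right_inv := ?_ }
  · refine cls_succ_of_arc (c' := c') (t := t) (x := !b) _ id (fun k p => rfl) (fun p => ?_)
      (fun p h1 h2 => ?_) (fun h => absurd h hb) (fun _ => ⟨?_, ?_⟩)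
    · simp only [Fin.cases_zero]
      by_cases e1 : p = i.castSucc
      · subst e1
        simp [hc, c.mate_ne]
      by_cases e2 : p = i.succ
      · subst e2
        simp [hc', c.mate_ne]
      by_cases e3 : p = c.mate i.castSucc
      · subst e3
        simp [hc, c.mate_ne, c.mate_mate]
      by_cases e4 : p = c.mate i.succ
      · subst e4
        simp [hc', c.mate_ne, c.mate_mate]
      rw [if_neg (by simp [sw, e3, e4]), if_neg (by simp [e1, e2]), ← h3 p e1 e2 e3 e4, cls_left]
    · simp only [Fin.cases_zero, h1, h2, or_self, if_false]
      rfl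
    · simp only [Fin.cases_zero, true_or, or_true, if_true]
      rw [← h2, cls_left]
    · exact ((congrArg _ h1).symm.trans (cls_left _)).symm
  · refine cls_of_arc_succ (c' := c') fun p => ?_
    have key : cls c r ((i, b) :: w) (consState (!b) i b t) 1 (c.mate i.castSucc) =
        cls c r ((i, b) :: w) (consState (!b) i b t) 1 (c.mate i.succ) := by
      rw [cls_straight (c.mate_ne _) hc, cls_straight hc' (c.mate_ne _), cls_left, cls_left,
        cls_cap_left hb]
    by_cases e1 : p = i.castSucc
    · rw [e1, h1, cls_cap_right hb]
    by_cases e2 : p = i.succ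
    · rw [e2, h1', cls_cap_right hb]
    by_cases e3 : p = c.mate i.castSucc
    · rw [e3, h2, key]
    by_cases e4 : p = c.mate i.succ
    · rw [e4, h2', key]
    rw [h3 p e1 e2 e3 e4, cls_straight e1 e2,
      cls_straight (by rwa [Ne, sw]) (by rwa [Ne, sw]), cls_left]
  · rintro ⟨k, p⟩
    cases k using Fin.cases with
    | zero =>
      by_cases e1 : p = i.castSucc
      · subst e1
        simpa using (cls_straight (c.mate_ne _) hc).trans (cls_left _)
      by_cases e2 : p = i.succ
      · subst e2
        simpa using (cls_straight hc' (c.mate_ne _)).trans (cls_left _)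
      simpa [e1, e2] using cls_straight e1 e2
    | succ k => rfl
  · rintro ⟨k, p⟩
    rfl

/-- Expansion of the bracket at the leftmost crossing. -/
lemma bracket_cons : (mk' c ((i, b) :: w) r).bracket =
    T (if b then 1 else -1) * (mk' c w r).bracket +
      T (if b then -1 else 1) * ∑ t : Fin w.length → Bool,
        T (∑ k, if t k then 1 else -1) *
          (-T 2 - T (-2)) ^ ((mk' c ((i, b) :: w) r).loops (consState (!b) i b t) - 1) := by
  have h : (mk' c ((i, b) :: w) r).bracket = ∑ x : Bool, ∑ t : Fin w.length → Bool,
      T (if x then 1 else -1) * (T (∑ k, if t k then 1 else -1) *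
        (-T 2 - T (-2)) ^ ((mk' c ((i, b) :: w) r).loops (consState x i b t) - 1)) := by
    rw [← Fintype.sum_prod_type']
    refine (Fintype.sum_equiv (Fin.consEquiv fun _ : Fin (w.length + 1) => Bool) _ _ ?_).symm
    rintro ⟨x, t⟩
    rw [← mul_assoc, ← T_add]
    congr 2
    exact (Fin.sum_univ_succ (fun k => if (consState x i b t) k then (1 : ℤ) else -1)).symm
  rw [h, Fintype.sum_bool, bracket]
  cases b
  · simp_rw [loops_cons_horizontal, ← Finset.mul_sum]
    rw [add_comm]
    simp
  · simp_rw [loops_cons_horizontal, ← Finset.mul_sum]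
    simp

lemma bracket_cons_of_mate (hc : c.mate i.castSucc = i.succ) :
    (mk' c ((i, b) :: w) r).bracket =
      (T (if b then 1 else -1) + T (if b then -1 else 1) * (-T 2 - T (-2))) *
        (mk' c w r).bracket := by
  rw [bracket_cons, add_mul, mul_assoc, bracket, Finset.mul_sum _ _ (-T 2 - T (-2))]
  congr 2
  refine Finset.sum_congr rfl fun t _ => ?_
  rw [loops_cons_cap_of_mate hc, mul_left_comm, ← pow_succ']
  have := loops_pos (mk' c w r) t
  congr 2
  omega

lemma bracket_cons_of_mate_ne (hc : c.mate i.castSucc ≠ i.succ)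
    (h1 : c'.mate i.castSucc = i.succ)
    (h2 : c'.mate (c.mate i.castSucc) = c.mate i.succ)
    (h3 : ∀ p, p ≠ i.castSucc → p ≠ i.succ → p ≠ c.mate i.castSucc → p ≠ c.mate i.succ →
      c'.mate p = c.mate p) :
    (mk' c ((i, b) :: w) r).bracket =
      T (if b then 1 else -1) * (mk' c w r).bracket +
        T (if b then -1 else 1) * (mk' c' w r).bracket := by
  rw [bracket_cons, bracket, bracket]
  congr 2
  refine Finset.sum_congr rfl fun t _ => ?_
  rw [loops_cons_cap_of_mate_ne hc h1 h2 h3]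

end PlatDiagram

/-! ### Orientations -/

namespace PlatDiagram

variable {n : ℕ} (D : PlatDiagram n)

/-- The position in the leftmost column of the strand through a point. -/
def strand (k : Fin (D.size + 1)) : Equiv.Perm (Fin (n + 1)) :=
  Fin.induction (motive := fun _ => Equiv.Perm (Fin (n + 1))) 1
    (fun k σ => σ * Equiv.swap (D.upper k) (D.lower k)) k

lemma strand_succ (k : Fin D.size) :
    D.strand k.succ = D.strand k.castSucc * Equiv.swap (D.upper k) (D.lower k) :=
  Fin.induction_succ _ _ _

/-- A coloring of the strands which is switched by the caps is an orientation. -/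
def orientationOfColoring (f : Fin (n + 1) → Bool) (hl : ∀ p, f (D.left.mate p) = !f p)
    (hr : ∀ p, f (D.strand (Fin.last _) (D.right.mate p)) = !f (D.strand (Fin.last _) p)) :
    D.Orientation where
  rightward x := f (D.strand x.1 x.2)
  left p := hl p
  right p := hr p
  straight k p hu hl := by
    simp only [strand_succ, Equiv.Perm.mul_apply, Equiv.swap_apply_of_ne_of_ne hu hl]
  descending k := by simp [strand_succ]
  ascending k := by simp [strand_succ]

end PlatDiagram

/-- The union of two perfect matchings of four points consists of even cycles, hence is 2-colorable.
-/
lemma exists_coloring : ∀ a b c d : Fin 4, a ≠ b → a ≠ c → a ≠ d → b ≠ c → b ≠ d → c ≠ d →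
    ∃ x y : Bool, (![x, !x, y, !y] : Fin 4 → Bool) d = !((![x, !x, y, !y] : Fin 4 → Bool) a) ∧
      (![x, !x, y, !y] : Fin 4 → Bool) c = !((![x, !x, y, !y] : Fin 4 → Bool) b) := by
  decide

lemma nonempty_orientation (a : List ℕ) : Nonempty (rationalLink a).Orientation := by
  set σ := (rationalLink a).strand (Fin.last _) with hσ
  have hi : ∀ {i j : Fin 4}, i ≠ j → σ i ≠ σ j := fun h => σ.injective.ne h
  obtain ⟨x, y, h1, h2⟩ := exists_coloring (σ 0) (σ 1) (σ 2) (σ 3) (hi (by decide))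
    (hi (by decide)) (hi (by decide)) (hi (by decide)) (hi (by decide)) (hi (by decide))
  refine ⟨(rationalLink a).orientationOfColoring ![x, !x, y, !y] ?_ ?_⟩
  · intro p
    fin_cases p <;> simp [rationalLink]
  · rw [← hσ]
    intro p
    fin_cases p
    · exact h1
    · exact h2
    · exact ((congrArg not h2).trans (Bool.not_not _)).symm
    · exact ((congrArg not h1).trans (Bool.not_not _)).symm

/-! ### The bracket of rational links -/

/-- The caps joining strands `0, 1` and `2, 3`. -/
def capsParallel : CapSystem 4 where
  mate := ![1, 0, 3, 2]
  mate_mate := by decide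
  mate_ne := by decide
  noncrossing := by decide

/-- The caps joining strands `0, 3` and `1, 2`. -/
def capsNested : CapSystem 4 where
  mate := ![3, 2, 1, 0]
  mate_mate := by decide
  mate_ne := by decide
  noncrossing := by decide

/-- The bracket of the word with left caps `c` and nested right caps. -/
def closureBracket (c : CapSystem 4) (w : List (Fin 3 × Bool)) : ℤ[T;T⁻¹] :=
  (PlatDiagram.mk' (n := 3) c w capsNested).bracket

open PlatDiagram in
lemma closureBracket_parallel_nil : closureBracket capsParallel [] = 1 := by
  have h : ∀ s, (mk' (n := 3) capsParallel [] capsNested).loops s = 1 := by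
    intro s
    rw [loops, Nat.card_eq_one_iff_unique]
    refine ⟨⟨?_⟩, ⟨Quot.mk _ (0, 0)⟩⟩
    have hl := fun p => cls_left (c := capsParallel) (r := capsNested) (w := []) (t := s) p
    have hr : ∀ p, cls capsParallel capsNested [] s 0 (capsNested.mate p) =
      cls capsParallel capsNested [] s 0 p := fun p => cls_right p
    have key : ∀ z, z = cls capsParallel capsNested [] s 0 0 := by
      rintro ⟨k, p⟩
      obtain rfl : k = 0 := Subsingleton.elim (α := Fin 1) _ _
      fin_cases p
      · rfl
      · exact hl 0
      · exact (hr 1).trans (hl 0)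
      · exact hr 0
    exact fun y z => (key y).trans (key z).symm
  have h0 : ∀ s : Fin 0 → Bool, (∑ k, if s k then (1 : ℤ) else -1) = 0 := fun s =>
    Fin.sum_univ_zero _
  rw [closureBracket, bracket]
  simp only [h]
  exact (Fintype.sum_unique (ι := Fin 0 → Bool) _).trans (by erw [h0]; simp)

open PlatDiagram in
lemma closureBracket_nested_nil : closureBracket capsNested [] = -T 2 - T (-2) := by
  have h : ∀ s, (mk' (n := 3) capsNested [] capsNested).loops s = 2 := by
    intro s
    have hl := fun p => cls_left (c := capsNested) (r := capsNested) (w := []) (t := s) p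
    rw [loops, ← Fintype.card_bool, ← Nat.card_eq_fintype_card]
    refine Nat.card_congr
      { toFun := Quot.lift (fun y => decide (y.2 = 0 ∨ y.2 = 3)) ?_
        invFun := fun x => cls capsNested capsNested [] s 0 (if x then 0 else 1)
        left_inv := ?_
        right_inv := ?_ }
    · have : ∀ p : Fin 4, decide (p = 0 ∨ p = 3) =
          decide (capsNested.mate p = 0 ∨ capsNested.mate p = 3) := by decide
      rintro _ _ (p | p | k | k | k | k | k)
      · exact this p
      · exact this p
      all_goals exact Fin.elim0 k
    · rintro ⟨k, p⟩
      obtain rfl : k = 0 := Subsingleton.elim (α := Fin 1) _ _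
      fin_cases p
      · rfl
      · rfl
      · exact (hl 1).symm
      · exact (hl 0).symm
    · rintro (_ | _) <;> rfl
  have h0 : ∀ s : Fin 0 → Bool, (∑ k, if s k then (1 : ℤ) else -1) = 0 := fun s =>
    Fin.sum_univ_zero _
  rw [closureBracket, bracket]
  simp only [h]
  exact (Fintype.sum_unique (ι := Fin 0 → Bool) _).trans (by erw [h0]; simp)

open PlatDiagram in
-- Nested caps already join the two middle strands, so capping them off there creates a loop; on
-- parallel caps it produces nested ones.
lemma closureBracket_false (w : List (Fin 3 × Bool)) :
    closureBracket capsParallel ((1, false) :: w) =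
        T (-1) * closureBracket capsParallel w + T 1 * closureBracket capsNested w ∧
      closureBracket capsNested ((1, false) :: w) =
        (T (-1) + T 1 * (-T 2 - T (-2))) * closureBracket capsNested w :=
  ⟨bracket_cons_of_mate_ne (c := capsParallel) (c' := capsNested) (by decide) (by decide)
    (by decide) (by decide), bracket_cons_of_mate (c := capsNested) (by decide)⟩

open PlatDiagram in
lemma closureBracket_true (w : List (Fin 3 × Bool)) :
    closureBracket capsParallel ((0, true) :: w) =
        (T 1 + T (-1) * (-T 2 - T (-2))) * closureBracket capsParallel w ∧
      closureBracket capsNested ((0, true) :: w) =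
        T 1 * closureBracket capsNested w + T (-1) * closureBracket capsParallel w :=
  ⟨bracket_cons_of_mate (c := capsParallel) (by decide),
    bracket_cons_of_mate_ne (c := capsNested) (c' := capsParallel) (by decide) (by decide)
    (by decide) (by decide)⟩

/-- The substitution `q = -A ^ 4`. -/
def substA : ℤ[X] →+* ℤ[T;T⁻¹] := eval₂RingHom (Int.castRingHom ℤ[T;T⁻¹]) (-T 4)

@[simp] lemma substA_X : substA X = -T 4 := by simp [substA]

lemma mem_rationalWord (a : List ℕ) : ∀ x ∈ rationalWord a, x = (1, false) ∨ x = (0, true) := by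
  induction a using rationalWord.induct with
  | case1 => simp [rationalWord]
  | case2 a => simp +contextual [rationalWord, List.mem_replicate]
  | case3 a b l ih =>
    intro x hx
    simp only [rationalWord, List.mem_append, List.mem_replicate] at hx
    rcases hx with (hx | hx) | hx
    · exact Or.inl hx.2
    · exact Or.inr hx.2
    · exact ih x hx

/-- The factor T 2 on the nested bracket turns both expansions into letter matrices in q = -A⁴, up
to the units A⁻¹ for `false` and -A⁻³ for `true`. -/
lemma exists_closureBracket_eq (w : List (Fin 3 × Bool))
    (hw : ∀ x ∈ w, x = (1, false) ∨ x = (0, true)) : ∃ (ε : ℤˣ) (k : ℤ),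
      closureBracket capsParallel w = (ε : ℤ) • (T k *
        substA (wordMat (w.map Prod.snd) 0 0 + (X - 1) * wordMat (w.map Prod.snd) 0 1)) ∧
      T 2 * closureBracket capsNested w = (ε : ℤ) • (T k *
        substA (wordMat (w.map Prod.snd) 1 0 + (X - 1) * wordMat (w.map Prod.snd) 1 1)) := by
  have e1 := T_one_mul_T_neg_one
  have e2 : (T 2 : ℤ[T;T⁻¹]) = T 1 ^ 2 := by simp [T_pow]
  have e3 : (T (-2) : ℤ[T;T⁻¹]) = T (-1) ^ 2 := by simp [T_pow]
  have e4 : (T 4 : ℤ[T;T⁻¹]) = T 1 ^ 4 := by simp [T_pow]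
  have e5 : (T (-3) : ℤ[T;T⁻¹]) = T (-1) ^ 3 := by simp [T_pow]
  induction w with
  | nil =>
    refine ⟨1, 0, ?_, ?_⟩
    · simp [closureBracket_parallel_nil]
    · simp [closureBracket_nested_nil]
      grind
  | cons x w ih =>
    obtain ⟨ε, k, h1, h2⟩ := ih fun y hy => hw y (List.mem_cons_of_mem _ hy)
    simp only [e2, e4, map_add, map_mul, map_sub, map_one, substA_X, zsmul_eq_mul] at h1 h2 ⊢
    rcases hw x List.mem_cons_self with rfl | rfl
    · refine ⟨ε, k + -1, ?_, ?_⟩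
      · rw [(closureBracket_false w).1]
        simp only [List.map_cons, wordMat_false_cons_zero, T_add, map_add]
        linear_combination T (-1) * h1 + T (-1) * h2 - T 1 * closureBracket capsNested w * e1
      · rw [(closureBracket_false w).2]
        simp only [List.map_cons, wordMat_false_cons_one, T_add, map_mul, substA_X, e2, e3, e4]
        linear_combination -T 1 ^ 4 * T (-1) * h2 +
          T 1 ^ 2 * closureBracket capsNested w * (T 1 ^ 3 - T (-1)) * e1
    · refine ⟨-ε, k + -3, ?_, ?_⟩
      · rw [(closureBracket_true w).1]
        simp only [List.map_cons, wordMat_true_cons_zero, T_add, e2, e3, e5, Units.val_neg,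
          Int.cast_neg]
        linear_combination -T (-1) ^ 3 * h1 - T 1 * closureBracket capsParallel w * e1
      · rw [(closureBracket_true w).2]
        simp only [List.map_cons, wordMat_true_cons_one, T_add, e4, e5, Units.val_neg,
          Int.cast_neg, map_mul, map_add, substA_X]
        linear_combination T 1 ^ 4 * T (-1) ^ 3 * h1 + T 1 ^ 4 * T (-1) ^ 3 * h2 -
          (T 1 ^ 3 * closureBracket capsNested w * (1 + T 1 * T (-1) + T 1 ^ 2 * T (-1) ^ 2) +
            T 1 ^ 2 * T (-1) * closureBracket capsParallel w * (1 + T 1 * T (-1))) * e1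

lemma jones_equivUnit_bracket {n : ℕ} (D : PlatDiagram n) (o : D.Orientation) :
    EquivUnit (D.jones o) D.bracket := ⟨(D.writhe o).negOnePow, -3 * D.writhe o, rfl⟩

lemma jones_equivUnit (a : List ℕ) (o : (rationalLink a).Orientation) :
    EquivUnit ((rationalLink a).jones o) (substA (jonesPoly (cfWord a))) := by
  refine (jones_equivUnit_bracket _ o).trans ?_
  obtain ⟨ε, k, h, -⟩ := exists_closureBracket_eq _ (mem_rationalWord a)
  exact ⟨ε, k, h⟩

lemma substA_eq_toLaurent (f : ℤ[X]) : substA f = toLaurent (f.comp (-X ^ 4)) := by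
  have : substA = (toLaurent : ℤ[X] →+* ℤ[T;T⁻¹]).comp (compRingHom (-X ^ 4)) := by
    ext
    · simp
    · simp
  rw [this]
  rfl

lemma eq_of_equivUnit_substA {F G : ℤ[X]} (hF : F.coeff 0 = 1) (hG : G.coeff 0 = 1)
    (h : EquivUnit (substA F) (substA G)) : F = G := by
  rw [substA_eq_toLaurent, substA_eq_toLaurent] at h
  have h0 : ∀ {F : ℤ[X]}, F.coeff 0 = 1 → 0 < (F.comp (-X ^ 4)).coeff 0 := by
    intro F hF
    rw [coeff_zero_eq_eval_zero, eval_comp]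
    simp [← coeff_zero_eq_eval_zero, hF]
  have := eq_of_equivUnit_toLaurent (h0 hF) (h0 hG) h
  rw [← sub_eq_zero, ← sub_comp, comp_eq_zero_iff] at this
  -- The alternative would make -X⁴ constant.
  rcases this with h | ⟨-, h⟩
  · exact sub_eq_zero.1 h
  · have := congrArg (fun f => coeff f 4) h
    simp [coeff_X_pow] at this

/-! ### Palindromicity -/

lemma exists_cons_append {a : List ℕ} (he : Even a.length) (hp : ∀ x ∈ a, 0 < x) (h : a ≠ []) :
    (∃ v, cfWord a = false :: v) ∧ ∃ v, cfWord a = v ++ [true] := by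
  induction a using rationalWord.induct with
  | case1 => exact absurd rfl h
  | case2 a => simp at he
  | case3 a b l ih =>
    have e : cfWord (a :: b :: l) =
        List.replicate a false ++ List.replicate b true ++ cfWord l := by
      simp [cfWord, rationalWord]
    obtain ⟨a, rfl⟩ := Nat.exists_eq_succ_of_ne_zero (hp a (by simp)).ne'
    obtain ⟨b, rfl⟩ := Nat.exists_eq_succ_of_ne_zero (hp b (by simp)).ne'
    rw [e]
    refine ⟨⟨_, by rw [List.replicate_succ]; rfl⟩, ?_⟩
    by_cases hl : l = []
    · subst hl
      refine ⟨List.replicate a.succ false ++ List.replicate b true, ?_⟩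
      rw [List.replicate_succ' (n := b), ← List.append_assoc]
      simp [cfWord, rationalWord]
    · obtain ⟨v, hv⟩ := (ih (by simpa [Nat.even_add_one] using he)
        (fun x hx => hp x (by simp [hx])) hl).2
      exact ⟨_, by rw [hv, ← List.append_assoc]⟩

/-- If `J` and its reversal differ by `(1 - q) Q` then `Q` is palindromic up to a unit. -/
lemma equivUnit_invert_of_reverse {J Jr Q : ℤ[X]} {n : ℤ}
    (h : toLaurent Jr = T n * invert (toLaurent J)) (hQ : Jr - J = (1 - X) * Q) :
    EquivUnit (invert (toLaurent Q)) (toLaurent Q) := by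
  have e1 := T_one_mul_T_neg_one
  have e2 : (T n * T (-n) : ℤ[T;T⁻¹]) = 1 := by rw [← T_add]; simp
  have h1 := congrArg invert h
  rw [map_mul, invert_T, involutive_invert] at h1
  have h2 := congrArg toLaurent hQ
  have h3 := congrArg invert h2
  simp only [map_mul, map_sub, map_one, toLaurent_X, invert_T] at h2 h3
  have hne : (1 - T 1 : ℤ[T;T⁻¹]) ≠ 0 := by
    rw [← toLaurent_X, ← map_one toLaurent, ← map_sub, toLaurent_ne_zero]
    intro h
    simpa using congrArg (fun f => coeff f 0) h
  -- Applying q ↦ q⁻¹ and multiplying by qⁿ exchanges J and its reversal, so it negates their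
  -- difference; 1 - q⁻¹ = -q⁻¹(1 - q) cancels this sign and supplies the extra factor q.
  refine ⟨1, 1 - n, mul_left_cancel₀ hne ?_⟩
  rw [show (1 : ℤ) - n = 1 + -n by ring, T_add, Units.val_one, one_smul]
  linear_combination T 1 * h3 - T 1 * h1 + T 1 * T (-n) * h2 - T 1 * T (-n) * h -
    T 1 * invert (toLaurent J) * e2 - invert (toLaurent Q) * e1

end

/-! ### Assembly of the theorem -/

theorem mainTheorem6 (α : ℚ) (hα : 1 < α) (a : List ℕ) (ha : IsEvenExpansion α a) :
    ∃ J : ℤ[X], (∀ J' : ℤ[X], IsNormalizedJones (rationalLink a) J' ↔ J' = J) ∧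
      ∃ I : ℤ[X], (∀ I' : ℤ[X], IsNormalizedQuotient J I' ↔ I' = I) ∧
        EquivUnit (toLaurent I) (Matrix.trace (-Sq * Mq a)) ∧
        (∀ k, 0 ≤ I.coeff k) ∧
        (¬ IsPalindromic J → I.coeff 0 = 1) := by
  have hne : a ≠ [] := by
    rintro rfl
    have := ha.value
    simp [cfValue] at this
    linarith
  obtain ⟨⟨v, hv⟩, ⟨u, hu⟩⟩ := exists_cons_append ha.even ha.pos hne
  have hJ0 : (jonesPoly (cfWord a)).coeff 0 = 1 := by
    rw [jonesPoly, coeff_add, wordMat_zero_zero_coeff, hu, mul_coeff_zero,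
      wordMat_append_true_zero_one_coeff, mul_zero, add_zero]
  refine ⟨jonesPoly (cfWord a), fun J' => ⟨fun h => ?_, ?_⟩, ?_⟩
  · obtain ⟨o⟩ := nonempty_orientation a
    exact eq_of_equivUnit_substA h.1 hJ0 ((h.2 o).symm.trans (jones_equivUnit a o))
  · rintro rfl
    exact ⟨hJ0, fun o => jones_equivUnit a o⟩
  obtain ⟨ε, k, F, hF, hF0, hF1⟩ := exists_trace_symplecticMat_mul (cfWord a)
  set c := wordMat v 1 0 with hc
  have hc' : wordMat (cfWord a) 1 0 = X * c := by
    simp [hv, hc, wordMat_cons, letterMat, Matrix.mul_apply]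
  set Q := wordMat (cfWord a) 0 1 - c with hQ
  set Jr := wordMat (cfWord a) 0 0 + (X - 1) * c with hJr
  have hdual : toLaurent Jr = _ := toLaurent_jonesPoly_dual hc'
  have hJr0 : Jr.coeff 0 = 1 := by
    rw [hJr, coeff_add, wordMat_zero_zero_coeff, mul_coeff_zero,
      X_dvd_iff.1 (wordMat_one_zero_dvd v), mul_zero, add_zero]
  -- Both constant terms are 1, so no power of q is lost and `Jr` is the reversal itself, not just
  -- equal to it up to a unit.
  have hrev : (jonesPoly (cfWord a)).reverse = Jr :=
    reverse_eq_of_toLaurent (by simp [hJ0]) (by simp [hJr0]) hdual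
  have hdiff : Jr - jonesPoly (cfWord a) = (1 - X) * Q := by
    rw [hJr, hQ, jonesPoly]
    ring
  have htr : (symplecticMat * wordMat (cfWord a)).trace = X * Q := by
    simp only [Matrix.trace_fin_two, Matrix.mul_apply, Fin.sum_univ_two, hc']
    simp [symplecticMat, hQ]
    ring
  have hFQ : EquivUnit (toLaurent F) (toLaurent Q) := by
    have h := congrArg toLaurent (htr.symm.trans hF)
    rw [map_zsmul, map_mul, map_mul, toLaurent_X, toLaurent_X_pow] at h
    exact (EquivUnit.symm ⟨ε, k, h⟩).trans (EquivUnit.T_mul _ _)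
  have hQQ := equivUnit_invert_of_reverse hdual hdiff
  have h1X : (1 - X : ℤ[X]) ≠ 0 := by
    intro h
    simpa using congrArg (fun f => coeff f 0) h
  have hpal : IsPalindromic (jonesPoly (cfWord a)) ↔ F = 0 := by
    rw [IsPalindromic, hrev, eq_comm, ← sub_eq_zero, hdiff, mul_eq_zero, or_iff_right h1X,
      ← toLaurent_eq_zero, ← hFQ.eq_zero_iff, toLaurent_eq_zero]
  have hFpal : F ≠ 0 → IsPalindromic F := by
    intro h
    -- The reversal has the leading coefficient of F as constant term; it is positive because F is
    -- nonzero with nonnegative coefficients.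
    refine eq_of_equivUnit_toLaurent (by rw [hF1 h]; exact one_pos) ?_ ?_
    · rw [coeff_zero_reverse]
      exact lt_of_le_of_ne (hF0 _) (leadingCoeff_ne_zero.2 h).symm
    · rw [toLaurent_reverse, mul_comm]
      exact hFQ.trans (((EquivUnit.T_mul _ _).trans (hFQ.invert.trans hQQ)).symm)
  refine ⟨F, fun I' => ⟨fun h => ?_, ?_⟩, ?_, hF0, fun h => hF1 fun h0 => h (hpal.2 h0)⟩
  · by_cases h0 : F = 0
    · rw [h0]
      exact h.1 (hpal.2 h0)
    · obtain ⟨-, hpos, Q', hQ', hI⟩ := h.2 fun hp => h0 (hpal.1 hp)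
      rw [hrev, hdiff] at hQ'
      rw [← mul_left_cancel₀ h1X hQ'] at hI
      exact eq_of_equivUnit_toLaurent hpos (by rw [hF1 h0]; exact one_pos) (hI.trans hFQ.symm)
  · rintro rfl
    refine ⟨hpal.1, fun h => ?_⟩
    have h0 : I' ≠ 0 := fun h0 => h (hpal.2 h0)
    exact ⟨hFpal h0, by rw [hF1 h0]; exact one_pos, Q, by rw [hrev, hdiff], hFQ⟩
  -- The trace is the quotient at q⁻¹ up to a unit; the symmetry `hQQ` brings it back to q.
  · refine EquivUnit.symm ((trace_Sq_mul_Mq a).trans ?_)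
    rw [htr, map_mul, toLaurentInv_X, toLaurentInv_apply]
    exact (EquivUnit.T_mul _ _).trans (hQQ.trans hFQ.symm)
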